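/- Let $(M,g)$ be a (connected) symmetric space, i.e. a connected smooth Riemannian manifold such that for every $p\in M$ there is an isometry $s_p$ of $M$ with $s_p(p)=p$ and $d(s_p)_p=-\mathrm{id}$. Let $(V,\langle\,,\rangle)$ be a finite-dimensional real vector space with a nondegenerate symmetric bilinear form (of any signature). A virtual immersion of $M$ with values in $V$ is a smooth $V$-valued one-form $\Omega$ on $M$ such that, for all $p\in M$ and $X,Y,Z\in T_pM$, $$\text{(a) } \langle\Omega(X),\Omega(Y)\rangle=g(X,Y),\qquad \text{(b) } \langle d\Omega(X,Y),\Omega(Z)\rangle=0 .$$ By (a), $V=\Omega(T_pM)\oplus\nu_pM$, where $\nu_pM=\Omega(T_pM)^\perp$. The second fundamental form of $\Omega$ is the tensor $I\!I(X,Y)=\big(D_X(\Omega(Y))\big)^{\perp}$, where $D$ is the flat connection of the trivial bundle $M\times V$ and $\perp$ denotes the $\nu M$-component. $\Omega$ is full if its image spans $V$. Two virtual immersions $\Omega_j:TM\to V_j$, $j=1,2$, are equivalent if there is a bijective linear isometry $L:(V_1,\langle\,,\rangle_1)\to(V_2,\langle\,,\rangle_2)$ with $\Omega_2=L\circ\Omega_1$.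 Proposition. Let $\Omega_j:TM\to V_j$, $j=1,2$, be full virtual immersions of the symmetric space $M$ whose second fundamental forms $I\!I_j$ are skew-symmetric. Then $\Omega_1$ and $\Omega_2$ are equivalent. -/

import Mathlib

open scoped Manifold ContDiff Bundle

noncomputable section

namespace VirtualImm

/-- A pseudo-Euclidean structure on a real vector space: a nondegenerate symmetric bilinear form
(of arbitrary signature). -/
structure PseudoEuclideanForm (V : Type*) [AddCommGroup V] [Module ℝ V] where
  /-- The bilinear form. -/
  form : LinearMap.BilinForm ℝ V
  symm : form.IsSymm
  nondegenerate : form.Nondegenerate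

variable {E : Type*} [NormedAddCommGroup E] [NormedSpace ℝ E]
  {H : Type*} [TopologicalSpace H] (I : ModelWithCorners ℝ E H)
  (M : Type*) [TopologicalSpace M] [ChartedSpace H M] [IsManifold I ∞ M]
  (V : Type*) [NormedAddCommGroup V] [NormedSpace ℝ V]

/-- A smooth `V`-valued one-form on `M`: a smooth map `TM → V` that is linear on each tangent
space. (For finite-dimensional `V` the choice of the norm of `V` is immaterial.) -/
structure OneForm where
  /-- The linear map `T_xM → V`. -/
  toFun : ∀ x : M, TangentSpace I x →L[ℝ] V
  contMDiff_toFun : ContMDiff I.tangent 𝓘(ℝ, V) ∞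
    (fun v : TangentBundle I M ↦ toFun v.proj v.snd)

variable {I M V}

namespace OneForm

instance : CoeFun (OneForm I M V) (fun _ ↦ ∀ x : M, TangentSpace I x →L[ℝ] V) := ⟨toFun⟩

variable (Ω : OneForm I M V)

/-- The derivative `D_X (Ω(Y))` at `x`, where `Ω(Y)` is the `V`-valued function `y ↦ Ω_y(Y_y)`, i.e.
a section of the trivial bundle `M × V`, and `D` is the flat connection of that bundle. -/
def flatDeriv (X Y : ∀ x : M, TangentSpace I x) (x : M) : V :=
  d% (fun y : M ↦ Ω y (Y y)) x (X x)

lemma mdifferentiableAt_apply {Y : ∀ x : M, TangentSpace I x} {x : M}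
    (hY : MDiffAt (T% Y) x) : MDiffAt (fun y : M ↦ Ω y (Y y)) x :=
  MDifferentiableAt.comp x
    (g := fun v : TangentBundle I M ↦ Ω v.proj v.snd) (I' := I.tangent)
    ((Ω.contMDiff_toFun _).mdifferentiableAt (by simp)) hY

lemma flatDeriv_smul_right {X Y : ∀ x : M, TangentSpace I x} {f : M → ℝ} {x : M}
    (hf : MDiffAt f x) (hY : MDiffAt (T% Y) x) :
    Ω.flatDeriv X (f • Y) x = f x • Ω.flatDeriv X Y x + (d% f x (X x)) • Ω x (Y x) := by
  have h : (fun y : M ↦ Ω y ((f • Y) y)) = f • (fun y : M ↦ Ω y (Y y)) := by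
    ext y; simp
  simp only [flatDeriv]
  rw [h, mvfderiv_smul hf (Ω.mdifferentiableAt_apply hY)]
  simp

lemma flatDeriv_add_right {X Y Y' : ∀ x : M, TangentSpace I x} {x : M}
    (hY : MDiffAt (T% Y) x) (hY' : MDiffAt (T% Y') x) :
    Ω.flatDeriv X (Y + Y') x = Ω.flatDeriv X Y x + Ω.flatDeriv X Y' x := by
  have h : (fun y : M ↦ Ω y ((Y + Y') y)) = (fun y : M ↦ Ω y (Y y)) + fun y ↦ Ω y (Y' y) := by
    ext y; simp
  simp only [flatDeriv]
  rw [h, mvfderiv_add (Ω.mdifferentiableAt_apply hY) (Ω.mdifferentiableAt_apply hY')]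
  simp

lemma flatDeriv_smul_left {X Y : ∀ x : M, TangentSpace I x} {f : M → ℝ} {x : M} :
    Ω.flatDeriv (f • X) Y x = f x • Ω.flatDeriv X Y x := by
  simp [flatDeriv]

lemma flatDeriv_add_left {X X' Y : ∀ x : M, TangentSpace I x} {x : M} :
    Ω.flatDeriv (X + X') Y x = Ω.flatDeriv X Y x + Ω.flatDeriv X' Y x := by
  simp [flatDeriv]

/-- `dΩ(X, Y) = D_X (Ω(Y)) - D_Y (Ω(X)) - Ω([X, Y])` for vector fields `X`, `Y`. -/
def extDerivField (X Y : ∀ x : M, TangentSpace I x) (x : M) : V :=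
  Ω.flatDeriv X Y x - Ω.flatDeriv Y X x - Ω x (VectorField.mlieBracket I X Y x)

variable [FiniteDimensional ℝ E]

lemma tensorialAt_extDerivField_left (x : M) (Y : ∀ x : M, TangentSpace I x) :
    TensorialAt I E (fun X ↦ Ω.extDerivField X Y x) x where
  smul hf hX := by
    have : CompleteSpace E := FiniteDimensional.complete ℝ E
    simp [extDerivField, Ω.flatDeriv_smul_right hf hX, flatDeriv_smul_left,
      VectorField.mlieBracket_smul_left hf hX]
    module
  add hX hX' := by
    have : CompleteSpace E := FiniteDimensional.complete ℝ E
    simp [extDerivField, Ω.flatDeriv_add_right hX hX', flatDeriv_add_left,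
      VectorField.mlieBracket_add_left hX hX']
    module

lemma tensorialAt_extDerivField_right (x : M) (X : ∀ x : M, TangentSpace I x) :
    TensorialAt I E (fun Y ↦ Ω.extDerivField X Y x) x where
  smul hf hX := by
    have : CompleteSpace E := FiniteDimensional.complete ℝ E
    simp [extDerivField, Ω.flatDeriv_smul_right hf hX, flatDeriv_smul_left,
      VectorField.mlieBracket_smul_right hf hX]
    module
  add hX hX' := by
    have : CompleteSpace E := FiniteDimensional.complete ℝ E
    simp [extDerivField, Ω.flatDeriv_add_right hX hX', flatDeriv_add_left,
      VectorField.mlieBracket_add_right hX hX']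
    module

/-- The exterior derivative of `Ω` at `x`, as a bilinear map on `T_xM`: the tensor induced by
`(X, Y) ↦ D_X (Ω(Y)) - D_Y (Ω(X)) - Ω([X, Y])`. -/
def extDeriv (x : M) : TangentSpace I x →L[ℝ] TangentSpace I x →L[ℝ] V :=
  TensorialAt.mkHom₂ (fun X Y ↦ Ω.extDerivField X Y x) x
    (fun Y _ ↦ Ω.tensorialAt_extDerivField_left x Y)
    (fun X _ ↦ Ω.tensorialAt_extDerivField_right x X)

lemma extDeriv_apply {X Y : ∀ x : M, TangentSpace I x} {x : M}
    (hX : MDiffAt (T% X) x) (hY : MDiffAt (T% Y) x) :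
    Ω.extDeriv x (X x) (Y x) = Ω.flatDeriv X Y x - Ω.flatDeriv Y X x
      - Ω x (VectorField.mlieBracket I X Y x) :=
  TensorialAt.mkHom₂_apply _ _ hX hY

end OneForm

variable [FiniteDimensional ℝ E] [Bundle.RiemannianBundle (fun x : M ↦ TangentSpace I x)]

variable (I M) in
/-- A virtual immersion of the Riemannian manifold `M` with values in the pseudo-Euclidean vector
space `(V, B)`. -/
structure VirtualImmersion (B : PseudoEuclideanForm V) extends OneForm I M V where
  isometric : ∀ (x : M) (u v : TangentSpace I x), B.form (toFun x u) (toFun x v) = inner ℝ u v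
  extDeriv_normal : ∀ (x : M) (u v w : TangentSpace I x),
    B.form (toOneForm.extDeriv x u v) (toFun x w) = 0

namespace VirtualImmersion

variable [FiniteDimensional ℝ V] {B : PseudoEuclideanForm V} (Ω : VirtualImmersion I M B)

instance : CoeFun (VirtualImmersion I M B) (fun _ ↦ ∀ x : M, TangentSpace I x →L[ℝ] V) :=
  ⟨fun Ω ↦ Ω.toFun⟩

/-- The image of `T_xM` in `V`. -/
def tangentImage (x : M) : Submodule ℝ V := LinearMap.range (Ω x : TangentSpace I x →ₗ[ℝ] V)

/-- The normal space `ν_xM` in `V`: the orthogonal complement of the image of `T_xM`. -/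
def normalSpace (x : M) : Submodule ℝ V := B.form.orthogonal (Ω.tangentImage x)

lemma isCompl_normal_tangent (x : M) : IsCompl (Ω.normalSpace x) (Ω.tangentImage x) := by
  have : FiniteDimensional ℝ (TangentSpace I x) := inferInstanceAs (FiniteDimensional ℝ E)
  have : FiniteDimensional ℝ (Ω.tangentImage x) := by
    unfold tangentImage; infer_instance
  refine ((LinearMap.BilinForm.isCompl_orthogonal_iff_disjoint B.symm.isRefl).2 ?_).symm
  rw [Submodule.disjoint_def]
  rintro _ ⟨u, rfl⟩ hu
  have h : B.form (Ω x u) (Ω x u) = 0 := hu _ ⟨u, rfl⟩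
  rw [Ω.isometric, inner_self_eq_zero] at h
  simp [h]

/-- The normal part `w ↦ w^⊥`: the projection of `V = T_xM ⊕ ν_xM` to `ν_xM`. -/
def normalPart (x : M) : V →ₗ[ℝ] V := (Ω.normalSpace x).projection (Ω.tangentImage x) (Ω.isCompl_normal_tangent x)

@[simp]
lemma normalPart_apply (x : M) (u : TangentSpace I x) : Ω.normalPart x (Ω x u) = 0 :=
  (Submodule.projection_apply_eq_zero_iff (Ω.isCompl_normal_tangent x)).2 ⟨u, rfl⟩

lemma tensorialAt_left (x : M) (Y : ∀ x : M, TangentSpace I x) :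
    TensorialAt I E (fun X ↦ Ω.normalPart x (Ω.flatDeriv X Y x)) x where
  smul _ _ := by simp [OneForm.flatDeriv_smul_left]
  add _ _ := by simp [OneForm.flatDeriv_add_left]

lemma tensorialAt_right (x : M) (X : ∀ x : M, TangentSpace I x) :
    TensorialAt I E (fun Y ↦ Ω.normalPart x (Ω.flatDeriv X Y x)) x where
  smul hf hY := by simp [Ω.flatDeriv_smul_right hf hY]
  add hY hY' := by simp [Ω.flatDeriv_add_right hY hY']

/-- The second fundamental form at `x`, as a bilinear map on `T_xM`: the tensor induced by
`(X, Y) ↦ (D_X (Ω(Y)))^⊥`. -/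
def secondFundamentalForm (x : M) : TangentSpace I x →L[ℝ] TangentSpace I x →L[ℝ] V :=
  TensorialAt.mkHom₂ (fun X Y ↦ Ω.normalPart x (Ω.flatDeriv X Y x)) x
    (fun Y _ ↦ Ω.tensorialAt_left x Y) (fun X _ ↦ Ω.tensorialAt_right x X)

lemma secondFundamentalForm_apply {X Y : ∀ x : M, TangentSpace I x} {x : M}
    (hX : MDiffAt (T% X) x) (hY : MDiffAt (T% Y) x) :
    Ω.secondFundamentalForm x (X x) (Y x) = Ω.normalPart x (Ω.flatDeriv X Y x) :=
  TensorialAt.mkHom₂_apply _ _ hX hY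

/-- The second fundamental form is skew-symmetric. -/
def IsSkew : Prop := ∀ (x : M) (u v : TangentSpace I x),
  Ω.secondFundamentalForm x u v = - Ω.secondFundamentalForm x v u

/-- The image of `Ω : TM → V` spans `V`. -/
def IsFull : Prop := Submodule.span ℝ {w : V | ∃ (x : M) (u : TangentSpace I x), Ω x u = w} = ⊤

/-- Two virtual immersions are equivalent if there is a linear isometry of the target spaces that
carries one to the other. -/
def Equivalent {V₁ V₂ : Type*} [NormedAddCommGroup V₁] [NormedSpace ℝ V₁]
    [NormedAddCommGroup V₂] [NormedSpace ℝ V₂]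
    {B₁ : PseudoEuclideanForm V₁} {B₂ : PseudoEuclideanForm V₂}
    (Ω₁ : VirtualImmersion I M B₁) (Ω₂ : VirtualImmersion I M B₂) : Prop :=
  ∃ L : V₁ ≃ₗ[ℝ] V₂, (∀ v w : V₁, B₂.form (L v) (L w) = B₁.form v w) ∧
    ∀ (x : M) (u : TangentSpace I x), L (Ω₁ x u) = Ω₂ x u

end VirtualImmersion

variable (I M) in
/-- A (globally) symmetric Riemannian space: a connected Riemannian manifold such that every point
`p` is fixed by an isometry whose differential at `p` is `-id`. -/
structure IsSymmetricSpace : Prop where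
  connected : ConnectedSpace M
  exists_symmetry : ∀ p : M, ∃ s : M ≃ₘ⟮I, I⟯ M,
    (∀ (x : M) (u v : TangentSpace I x),
      inner ℝ (mfderiv I I s x u) (mfderiv I I s x v) = inner ℝ u v) ∧
    s p = p ∧ ∀ u : TangentSpace I p, tangentMap I I s ⟨p, u⟩ = ⟨p, -u⟩

end VirtualImm

end

/-! In a chart, a virtual immersion `Ω` is a smooth map `η : E → E →L[ℝ] V`. Condition (b) makes the
tangential part of `fderiv ℝ η` torsion-free and (a) makes it metric, so it is the Levi-Civita
connection and depends only on `g`. Skew-symmetry of the second fundamental form says that the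
symmetric part of `fderiv ℝ η` is tangential: it equals `η` applied to a Christoffel term.

The two immersions have the same Christoffel terms, so the pair `(Ω₁, Ω₂)`, with values in `V₁ ×
V₂`, has this property as well (`sym_fderiv_pairInChart_mem_range`). Differentiating it and
permuting arguments as in Koszul's formula expresses the second derivative of the pair through its
values and first derivatives (`snd_fderiv_eq_of_sym_mem_range`). The equation is closed and linear,
so a functional on `V₁ × V₂` that kills the pair to first order at one point kills it nearby
(`exists_ball_forall_annihilate`), and then on all of the connected `M`
(`annihilate_of_eventually`).

For fixed `u ∈ T_pM` this applies to `φ(x, y) = ⟨Ω₁ u, x⟩₁ - ⟨Ω₂ u, y⟩₂`. At `p`, the value of `φ`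
on the pair vanishes by (a) and its first derivative because Christoffel symbols of the first kind
are metric. Hence `⟨Ω₁ u, Ω₁ w⟩₁ = ⟨Ω₂ u, Ω₂ w⟩₂` for tangent vectors at any two points
(`form_apply_eq`). Two spanning families with equal Gram matrices in nondegenerate spaces differ by
a linear isometry. -/

open Filter Topology

/-! ### Vector-valued one-forms on a vector space: the closed differential system -/

section Local

set_option maxSynthPendingDepth 3

variable {E V : Type*} [NormedAddCommGroup E] [NormedSpace ℝ E]
  [NormedAddCommGroup V] [NormedSpace ℝ V]

/-- The derivative of a smooth map is locally bounded. -/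
lemma exists_eventually_norm_fderiv_le {f : E → V} {n : WithTop ℕ∞} {x₀ : E}
    (hf : ContDiffAt ℝ n f x₀) (hn : 1 ≤ n) :
    ∃ C, ∀ᶠ y in 𝓝 x₀, ∀ a, ‖fderiv ℝ f y a‖ ≤ C * ‖a‖ := by
  refine ⟨‖fderiv ℝ f x₀‖ + 1, ?_⟩
  have h : ContinuousAt (fderiv ℝ f) x₀ :=
    (hf.fderiv_right (m := 0) (by simpa using hn)).continuousAt
  filter_upwards [h.norm.eventually (ge_mem_nhds (lt_add_one _))] with y hy a
  exact ((fderiv ℝ f y).le_opNorm a).trans (by gcongr)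

/-- A smooth family of linear maps that is injective at a point has a smooth family of left
inverses near that point. -/
lemma exists_contDiffAt_leftInverse [FiniteDimensional ℝ E] [FiniteDimensional ℝ V]
    {n : WithTop ℕ∞}    {η : E → E →L[ℝ] V} {x₀ : E}
    (hη : ContDiffAt ℝ n η x₀) (hinj : Function.Injective (η x₀)) :
    ∃ G : E → V →L[ℝ] E, ContDiffAt ℝ n G x₀ ∧ ∀ᶠ y in 𝓝 x₀, ∀ u, G y (η y u) = u := by
  have : CompleteSpace E := FiniteDimensional.complete ℝ E
  -- A fixed left inverse `l` of `η x₀` suffices: `l ∘ η y` stays invertible for `y` near `x₀`, and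
  -- `(l ∘ η y)⁻¹ ∘ l` is the required family.
  obtain ⟨l, hl⟩ := (η x₀ : E →ₗ[ℝ] V).exists_leftInverse_of_injective
    (LinearMap.ker_eq_bot.2 hinj)
  let l' : V →L[ℝ] E := LinearMap.toContinuousLinearMap l
  have h0 : l' ∘L η x₀ = ContinuousLinearMap.id ℝ E := by
    ext u; exact congr($hl u)
  have hsm : ContDiffAt ℝ n (fun y ↦ l' ∘L η y) x₀ := contDiffAt_const.clm_comp hη
  have hinv : (l' ∘L η x₀).IsInvertible := by
    rw [h0]; exact ⟨ContinuousLinearEquiv.refl ℝ E, rfl⟩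
  refine ⟨fun y ↦ (l' ∘L η y).inverse ∘L l', ?_, ?_⟩
  · exact (ContDiffAt.comp x₀ (g := ContinuousLinearMap.inverse) hinv.contDiffAt_map_inverse
      hsm).clm_comp contDiffAt_const
  · have hev : ∀ᶠ y in 𝓝 x₀, (l' ∘L η y).IsInvertible := by
      obtain ⟨e, he⟩ := hinv
      have : ∀ᶠ f in 𝓝 (l' ∘L η x₀), f ∈ Set.range ((↑) : (E ≃L[ℝ] E) → E →L[ℝ] E) := by
        rw [← he]; exact ContinuousLinearEquiv.nhds e
      exact hsm.continuousAt.eventually this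
    filter_upwards [hev] with y hy u
    obtain ⟨e, he⟩ := hy
    have h2 : l' (η y u) = e u := by
      rw [← ContinuousLinearEquiv.coe_coe, he]; rfl
    simp [← he, h2]

/-- Let `η` be a one-form with values in a vector space `V` such that the symmetric part of its
derivative takes values in the image of `η`. Then the second derivative takes values in the sum of
the image of `η` and the span of the values of the first derivative. -/
lemma snd_fderiv_eq_of_sym_mem_range {η : E → E →L[ℝ] V} {G : E → V →L[ℝ] E} {y : E}
    (hη : ContDiffAt ℝ 2 η y) (hG : DifferentiableAt ℝ G y)
    (hGη : ∀ᶠ x in 𝓝 y, ∀ u, G x (η x u) = u)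
    (hsym : ∀ᶠ x in 𝓝 y, ∀ u v, fderiv ℝ η x u v + fderiv ℝ η x v u ∈ Set.range (η x))
    (a u v : E) :
    ∃ τ, (2 : ℝ) • fderiv ℝ (fderiv ℝ η) y a u v
      = fderiv ℝ η y a (G y (fderiv ℝ η y u v + fderiv ℝ η y v u))
      + fderiv ℝ η y u (G y (fderiv ℝ η y a v + fderiv ℝ η y v a))
      - fderiv ℝ η y v (G y (fderiv ℝ η y a u + fderiv ℝ η y u a)) + η y τ := by
  have hd : DifferentiableAt ℝ η y := hη.differentiableAt (by norm_num)
  have hd2 : DifferentiableAt ℝ (fderiv ℝ η) y :=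
    (hη.fderiv_right (m := 1) (by norm_num)).differentiableAt (by norm_num)
  have hsnd : ∀ a u, fderiv ℝ (fderiv ℝ η) y a u = fderiv ℝ (fderiv ℝ η) y u a := fun a u ↦
    hη.isSymmSndFDerivAt (by simp) a u
  have key (a u v : E) : ∃ τ, fderiv ℝ (fderiv ℝ η) y a u v + fderiv ℝ (fderiv ℝ η) y a v u
      = fderiv ℝ η y a (G y (fderiv ℝ η y u v + fderiv ℝ η y v u)) + η y τ := by
    let s : E → V := fun x ↦ fderiv ℝ η x u v + fderiv ℝ η x v u
    have hs : HasFDerivAt s (((fderiv ℝ (fderiv ℝ η) y).flip u).flip v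
        + ((fderiv ℝ (fderiv ℝ η) y).flip v).flip u) y := by
      have h (u v : E) : HasFDerivAt (fun x ↦ fderiv ℝ η x u v)
          (((fderiv ℝ (fderiv ℝ η) y).flip u).flip v) y := by
        have := (hd2.hasFDerivAt.clm_apply (hasFDerivAt_const u y)).clm_apply
          (hasFDerivAt_const v y)
        convert this using 1
        ext b; simp
      exact (h u v).add (h v u)
    have hΓ : HasFDerivAt (fun x ↦ G x (s x)) (fderiv ℝ (fun x ↦ G x (s x)) y) y :=
      (hG.clm_apply hs.differentiableAt).hasFDerivAt
    have h2 := hd.hasFDerivAt.clm_apply hΓ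
    -- As `s` is in the range of `η`, it equals `η (G s)`; the product rule then splits its
    -- derivative into a `fderiv ℝ η` term and a term in the image of `η`.
    have heq : s =ᶠ[𝓝 y] fun x ↦ η x (G x (s x)) := by
      filter_upwards [hGη, hsym] with x h1 h2
      obtain ⟨w, hw⟩ := h2 u v
      change fderiv ℝ η x u v + fderiv ℝ η x v u = _
      rw [show s x = η x w from hw.symm, h1, hw]
    have h3 := congr($(hs.unique (h2.congr_of_eventuallyEq heq)) a)
    refine ⟨fderiv ℝ (fun x ↦ G x (s x)) y a, ?_⟩
    simp only [add_apply, ContinuousLinearMap.flip_apply,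
      ContinuousLinearMap.comp_apply] at h3
    rw [h3, add_comm]
  obtain ⟨τ₁, h₁⟩ := key a u v
  obtain ⟨τ₂, h₂⟩ := key u a v
  obtain ⟨τ₃, h₃⟩ := key v a u
  -- Koszul's permutation: the second derivative is symmetric in its first two arguments, so this
  -- alternating sum of the three identities leaves twice one term.
  refine ⟨τ₁ + τ₂ - τ₃, ?_⟩
  rw [hsnd u a] at h₂
  rw [hsnd v a, hsnd v u] at h₃
  rw [map_sub (η y), map_add (η y)]
  have := congr($h₁ + $h₂ - $h₃)
  rw [← sub_eq_zero]
  rw [← sub_eq_zero] at this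
  rw [← this, two_smul]
  abel

/-- A quantitative version of `snd_fderiv_eq_of_sym_mem_range`, for a functional `φ`. -/
lemma abs_apply_snd_fderiv_le {η : E → E →L[ℝ] V} {G : E → V →L[ℝ] E} {y : E}
    (hη : ContDiffAt ℝ 2 η y) (hG : DifferentiableAt ℝ G y)
    (hGη : ∀ᶠ x in 𝓝 y, ∀ u, G x (η x u) = u)
    (hsym : ∀ᶠ x in 𝓝 y, ∀ u v, fderiv ℝ η x u v + fderiv ℝ η x v u ∈ Set.range (η x))
    {C : ℝ} (c1 : ‖G y‖ ≤ C) (c2 : ∀ a, ‖fderiv ℝ η y a‖ ≤ C * ‖a‖) 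
    (c3 : ∀ a, ‖fderiv ℝ (fderiv ℝ η) y a‖ ≤ C * ‖a‖)
    {φ : V →L[ℝ] ℝ} {m : ℝ} (hm : 0 ≤ m)
    (hm0 : ∀ u, |φ (η y u)| ≤ m * ‖u‖) (hm1 : ∀ u v, |φ (fderiv ℝ η y u v)| ≤ m * ‖u‖ * ‖v‖)
    (a u v : E) : |φ (fderiv ℝ (fderiv ℝ η) y a u v)| ≤
      (3 * C ^ 2 + C * (C + 3 * C ^ 3)) * m * ‖a‖ * ‖u‖ * ‖v‖ := by
  have hC0 : 0 ≤ C := (norm_nonneg _).trans c1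
  obtain ⟨τ, hτ⟩ := snd_fderiv_eq_of_sym_mem_range hη hG
    hGη hsym a u v
  have d2 (u v : E) : ‖fderiv ℝ η y u v‖ ≤ C * ‖u‖ * ‖v‖ :=
    ((fderiv ℝ η y u).le_opNorm v).trans (by gcongr; exact c2 u)
  have d3 : ‖fderiv ℝ (fderiv ℝ η) y a u v‖ ≤ C * ‖a‖ * ‖u‖ * ‖v‖ := by
    refine (((fderiv ℝ (fderiv ℝ η) y a).le_opNorm₂ u v)).trans ?_
    gcongr
    exact c3 a
  have dG (w : V) : ‖G y w‖ ≤ C * ‖w‖ := ((G y).le_opNorm w).trans (by gcongr)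
  set Γ : E → E → E := fun u v ↦ G y (fderiv ℝ η y u v + fderiv ℝ η y v u) with hΓ
  have dΓ (u v : E) : ‖Γ u v‖ ≤ 2 * C ^ 2 * ‖u‖ * ‖v‖ := by
    calc ‖Γ u v‖ ≤ C * ‖fderiv ℝ η y u v + fderiv ℝ η y v u‖ := dG _
      _ ≤ C * (C * ‖u‖ * ‖v‖ + C * ‖v‖ * ‖u‖) := by
        gcongr; exact (norm_add_le _ _).trans (add_le_add (d2 _ _) (d2 _ _))
      _ = _ := by ring
  -- Applying the left inverse `G y` to the identity recovers `τ`, so no bound on the derivative of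
  -- `G` is needed.
  have hτ' : τ = G y ((2 : ℝ) • fderiv ℝ (fderiv ℝ η) y a u v - (fderiv ℝ η y a (Γ u v)
      + fderiv ℝ η y u (Γ a v) - fderiv ℝ η y v (Γ a u))) := by
    rw [hτ, add_sub_cancel_left, hGη.self_of_nhds]
  have eΓ (a u v : E) : ‖fderiv ℝ η y a (Γ u v)‖ ≤ 2 * C ^ 3 * (‖a‖ * ‖u‖ * ‖v‖) := by
    refine (d2 _ _).trans ?_
    calc C * ‖a‖ * ‖Γ u v‖ ≤ C * ‖a‖ * (2 * C ^ 2 * ‖u‖ * ‖v‖) := by gcongr; exact dΓ _ _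
      _ = _ := by ring
  have fΓ (a u v : E) : |φ (fderiv ℝ η y a (Γ u v))| ≤ m * 2 * C ^ 2 * (‖a‖ * ‖u‖ * ‖v‖) := by
    refine (hm1 _ _).trans ?_
    calc m * ‖a‖ * ‖Γ u v‖ ≤ m * ‖a‖ * (2 * C ^ 2 * ‖u‖ * ‖v‖) := by gcongr; exact dΓ _ _
      _ = _ := by ring
  have dτ : ‖τ‖ ≤ C * (2 * C + 6 * C ^ 3) * (‖a‖ * ‖u‖ * ‖v‖) := by
    rw [hτ']
    refine (dG _).trans ?_
    rw [mul_assoc]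
    gcongr
    refine (norm_sub_le _ _).trans ?_
    have e1 := (norm_sub_le (fderiv ℝ η y a (Γ u v) + fderiv ℝ η y u (Γ a v))
      (fderiv ℝ η y v (Γ a u)))
    have e2 := norm_add_le (fderiv ℝ η y a (Γ u v)) (fderiv ℝ η y u (Γ a v))
    have e3 : ‖(2 : ℝ) • fderiv ℝ (fderiv ℝ η) y a u v‖ ≤ 2 * (C * ‖a‖ * ‖u‖ * ‖v‖) := by
      rw [norm_smul]; norm_num; exact d3
    linarith [eΓ a u v, eΓ u a v, eΓ v a u]
  have h2 : 2 * φ (fderiv ℝ (fderiv ℝ η) y a u v) = φ (fderiv ℝ η y a (Γ u v))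
      + φ (fderiv ℝ η y u (Γ a v)) - φ (fderiv ℝ η y v (Γ a u)) + φ (η y τ) := by
    rw [← smul_eq_mul, ← map_smul, hτ]; simp [hΓ]
  have g1 : |φ (η y τ)| ≤ m * (C * (2 * C + 6 * C ^ 3) * (‖a‖ * ‖u‖ * ‖v‖)) :=
    (hm0 τ).trans (by gcongr)
  have t1 := abs_add_le (φ (fderiv ℝ η y a (Γ u v))
      + φ (fderiv ℝ η y u (Γ a v)) - φ (fderiv ℝ η y v (Γ a u))) (φ (η y τ))
  have t2 := abs_sub (φ (fderiv ℝ η y a (Γ u v))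
      + φ (fderiv ℝ η y u (Γ a v))) (φ (fderiv ℝ η y v (Γ a u)))
  have t3 := abs_add_le (φ (fderiv ℝ η y a (Γ u v))) (φ (fderiv ℝ η y u (Γ a v)))
  have t4 : 2 * |φ (fderiv ℝ (fderiv ℝ η) y a u v)| = |φ (fderiv ℝ η y a (Γ u v))
      + φ (fderiv ℝ η y u (Γ a v)) - φ (fderiv ℝ η y v (Γ a u)) + φ (η y τ)| := by
    rw [← h2, abs_mul]; norm_num
  -- After halving: `3 * C ^ 2` comes from the three terms in `Γ`, each at most `2 * C ^ 2 * m`, and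
  -- `C * (C + 3 * C ^ 3)` from the bound on `τ`.
  have hKm : (3 * C ^ 2 + C * (C + 3 * C ^ 3)) * m * ‖a‖ * ‖u‖ * ‖v‖ = (3 * C ^ 2 + C * (C + 3 * C ^ 3)) * m
    * (‖a‖ * ‖u‖ * ‖v‖) := by ring
  rw [hKm]
  linarith [fΓ a u v, fΓ u a v, fΓ v a u]

/-- The chain rule along a curve. -/
lemma hasDerivAt_comp_of_differentiableAt {f : E → V} {c : ℝ → E} {a : E} {t : ℝ}
    (hf : DifferentiableAt ℝ f (c t)) (hc : HasDerivAt c a t) :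
    HasDerivAt (fun t ↦ f (c t)) (fderiv ℝ f (c t) a) t :=
  hf.hasFDerivAt.comp_hasDerivAt t hc

/-- Uniqueness for a linear system of two ordinary differential equations on `[0, 1]`. -/
lemma eq_zero_of_norm_deriv_le_mul_max {A B : Type*} [NormedAddCommGroup A] [NormedSpace ℝ A]
    [NormedAddCommGroup B] [NormedSpace ℝ B] {f f' : ℝ → A} {g g' : ℝ → B} {K : ℝ}
    (hf : ∀ t ∈ Set.Icc (0 : ℝ) 1, HasDerivAt f (f' t) t)
    (hg : ∀ t ∈ Set.Icc (0 : ℝ) 1, HasDerivAt g (g' t) t) (hf0 : f 0 = 0) (hg0 : g 0 = 0)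
    (hf' : ∀ t ∈ Set.Icc (0 : ℝ) 1, ‖f' t‖ ≤ K * max ‖f t‖ ‖g t‖)
    (hg' : ∀ t ∈ Set.Icc (0 : ℝ) 1, ‖g' t‖ ≤ K * max ‖f t‖ ‖g t‖) : f 1 = 0 :=
  -- The norm of a product is the maximum, so the system is a single inequality for `(f, g)`.
  congrArg Prod.fst <| eq_zero_of_abs_deriv_le_mul_abs_self_of_eq_zero_right
    (f := fun t ↦ (f t, g t)) (f' := fun t ↦ (f' t, g' t)) (K := K) (a := 0) (b := 1)
    (fun t ht ↦ ((hf t ht).continuousAt.prodMk (hg t ht).continuousAt).continuousWithinAt)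
    (fun t ht ↦ ((hf t (Set.Ico_subset_Icc_self ht)).prodMk
      (hg t (Set.Ico_subset_Icc_self ht))).hasDerivWithinAt)
    (Prod.ext hf0 hg0)
    (fun t ht ↦ max_le (hf' t (Set.Ico_subset_Icc_self ht)) (hg' t (Set.Ico_subset_Icc_self ht)))
    1 (by simp)

/-- If the symmetric part of the derivative of a one-form `η` takes values in the image of `η`, then
near any point every functional that annihilates `η` to first order at one point annihilates it. -/
lemma exists_ball_forall_annihilate [FiniteDimensional ℝ E] [FiniteDimensional ℝ V]
    {η : E → E →L[ℝ] V} {x₀ : E}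
    (hη : ContDiffAt ℝ ∞ η x₀) (hinj : Function.Injective (η x₀))
    (hsym : ∀ᶠ y in 𝓝 x₀, ∀ u v, fderiv ℝ η y u v + fderiv ℝ η y v u ∈ Set.range (η y)) :
    ∃ r > 0, ∀ y ∈ Metric.ball x₀ r, ∀ φ : V →L[ℝ] ℝ, (∀ u, φ (η y u) = 0) →
      (∀ u v, φ (fderiv ℝ η y u v) = 0) → ∀ z ∈ Metric.ball x₀ r, ∀ u, φ (η z u) = 0 := by
  obtain ⟨G, hG, hGη⟩ := exists_contDiffAt_leftInverse hη hinj
  have hη' : ContDiffAt ℝ ∞ (fderiv ℝ η) x₀ := hη.fderiv_right (by simp)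
  obtain ⟨C₁, hC₁⟩ := exists_eventually_norm_fderiv_le hη (by simp)
  obtain ⟨C₂, hC₂⟩ := exists_eventually_norm_fderiv_le hη' (by simp)
  have hsm2 : ∀ᶠ y in 𝓝 x₀, ContDiffAt ℝ 2 η y :=
    (hη.of_le (m := 2) (WithTop.coe_le_coe.2 le_top)).eventually (by simp)
  have hGsm : ∀ᶠ y in 𝓝 x₀, ContDiffAt ℝ 1 G y :=
    (hG.of_le (m := 1) (WithTop.coe_le_coe.2 le_top)).eventually (by simp)
  obtain ⟨C, hC⟩ : ∃ C : ℝ, C = max (‖G x₀‖ + 1) (max C₁ C₂) := ⟨_, rfl⟩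
  have hC1 : ‖G x₀‖ + 1 ≤ C := by rw [hC]; exact le_max_left _ _
  have hC2 : C₁ ≤ C := by
    rw [hC]; exact (le_max_left _ _).trans (le_max_right _ _)
  have hC3 : C₂ ≤ C := by
    rw [hC]; exact (le_max_right _ _).trans (le_max_right _ _)
  have hC0 : 0 ≤ C := le_trans (by positivity) hC1
  -- One ball on which all bounds hold: its radius does not depend on the starting point `y`, which
  -- the closedness argument on `M` requires. The `eventually_nhds` forms keep the identities
  -- differentiable at every point of the ball.
  have hall := ((hG.continuousAt.norm.eventually (ge_mem_nhds (lt_add_one _))).and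
    hC₁).and
    (hC₂.and (hGη.eventually_nhds.and (hsym.eventually_nhds.and (hsm2.and hGsm))))
  obtain ⟨r, hr, hball⟩ := Metric.eventually_nhds_iff_ball.1 hall
  refine ⟨r, hr, fun y hy φ h0 h1 z hz ↦ ?_⟩
  set K : ℝ := 3 * C ^ 2 + C * (C + 3 * C ^ 3) with hK
  have hK0 : 0 ≤ K := by positivity
  -- Gronwall along the segment
  let a : E := z - y
  let c : ℝ → E := fun t ↦ y + t • a
  have hc (t : ℝ) (ht : t ∈ Set.Icc (0 : ℝ) 1) : c t ∈ Metric.ball x₀ r := by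
    have := (convex_ball x₀ r).add_smul_sub_mem hy hz ht
    exact this
  let P : (E →L[ℝ] V) →L[ℝ] (E →L[ℝ] ℝ) := ContinuousLinearMap.compL ℝ E V ℝ φ
  have hcd (t : ℝ) : HasDerivAt c a t := by
    have h := ((hasDerivAt_id t).smul_const a).const_add y
    rwa [one_smul] at h
  have hd (t : ℝ) (ht : t ∈ Set.Icc (0 : ℝ) 1) :
      DifferentiableAt ℝ η (c t) ∧ DifferentiableAt ℝ (fderiv ℝ η) (c t) := by
    obtain ⟨-, -, -, -, hs2, -⟩ := hball _ (hc t ht)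
    exact ⟨hs2.differentiableAt (by norm_num),
      (hs2.fderiv_right (m := 1) (by norm_num)).differentiableAt (by norm_num)⟩
  have hg (t : ℝ) (ht : t ∈ Set.Icc (0 : ℝ) 1) : HasDerivAt (fun t ↦ P ∘L fderiv ℝ η (c t))
      (P ∘L fderiv ℝ (fderiv ℝ η) (c t) a) t := by
    have h1 : HasDerivAt (fun t ↦ fderiv ℝ η (c t)) (fderiv ℝ (fderiv ℝ η) (c t) a) t :=
      hasDerivAt_comp_of_differentiableAt (hd t ht).2 (hcd t)
    have h2 := (hasDerivAt_const t P).clm_comp h1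
    simpa using h2
  -- The system for `f = φ ∘ η` and `g = φ ∘ fderiv ℝ η` along the segment: `f'` is `g` evaluated at
  -- `a`, whence the constant `‖a‖`, and `g'` is bounded by `abs_apply_snd_fderiv_le`, whence `K *
  -- ‖a‖`.
  have hzero := eq_zero_of_norm_deriv_le_mul_max
    (f := fun t ↦ P (η (c t))) (f' := fun t ↦ P (fderiv ℝ η (c t) a))
    (g := fun t ↦ P ∘L fderiv ℝ η (c t)) (g' := fun t ↦ P ∘L fderiv ℝ (fderiv ℝ η) (c t) a)
    (K := max ‖a‖ (K * ‖a‖))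
    (fun t ht ↦ P.hasFDerivAt.comp_hasDerivAt t ((hd t ht).1.hasFDerivAt.comp_hasDerivAt t (hcd t)))
    hg ?_ ?_ ?_ ?_
  · intro u
    have h := congr($hzero u)
    simpa [c, a, P] using h
  · ext u; simpa [c, P] using h0 u
  · ext u v; simpa [c, P] using h1 u v
  all_goals
    intro t ht
    have hx := hc t ht
    obtain ⟨⟨b1, b2⟩, b3, hGη', hsym', hs2, hGs⟩ := hball _ hx
    set m : ℝ := max ‖P (η (c t))‖ ‖P ∘L fderiv ℝ η (c t)‖
    have hm : 0 ≤ m := (norm_nonneg _).trans (le_max_left _ _)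
    have hm0 (u : E) : |φ (η (c t) u)| ≤ m * ‖u‖ :=
      ((P (η (c t))).le_opNorm u).trans (by gcongr; exact le_max_left _ _)
    have hm1 (u v : E) : |φ (fderiv ℝ η (c t) u v)| ≤ m * ‖u‖ * ‖v‖ :=
      ((P ∘L fderiv ℝ η (c t)).le_opNorm₂ u v).trans (by gcongr; exact le_max_right _ _)
  · refine le_trans ?_ (mul_le_mul_of_nonneg_right (le_max_left _ _) hm)
    refine ContinuousLinearMap.opNorm_le_bound _ (by positivity) fun v ↦ ?_
    exact (hm1 a v).trans (le_of_eq (by ring))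
  · refine le_trans ?_ (mul_le_mul_of_nonneg_right (le_max_right _ _) hm)
    refine ContinuousLinearMap.opNorm_le_bound₂ _ (by positivity) fun u v ↦ ?_
    exact (abs_apply_snd_fderiv_le hs2 (hGs.differentiableAt (by norm_num)) hGη' hsym'
        (b1.trans hC1) (fun a ↦ (b2 a).trans (by gcongr)) (fun a ↦ (b3 a).trans (by gcongr)) hm hm0
        hm1 a u v).trans (le_of_eq (by ring))

end Local

namespace VirtualImm

/-! ### Virtual immersions in a chart -/

section Chart

set_option maxSynthPendingDepth 3

variable {E : Type*} [NormedAddCommGroup E] [NormedSpace ℝ E]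
  {M : Type*} [TopologicalSpace M] [ChartedSpace E M]
  {V : Type*} [NormedAddCommGroup V] [NormedSpace ℝ V]

/-- A constant vector field on a vector space. -/
def constField (u : E) : ∀ x : E, TangentSpace 𝓘(ℝ, E) x := fun _ ↦ u

/-- The vector field on `M` which is the constant `u` in the preferred chart at `p₀`. -/
noncomputable def coordField (p₀ : M) (u : E) : ∀ p : M, TangentSpace 𝓘(ℝ, E) p :=
  VectorField.mpullback 𝓘(ℝ, E) 𝓘(ℝ, E) (extChartAt 𝓘(ℝ, E) p₀) (constField u)

variable [IsManifold 𝓘(ℝ, E) ∞ M]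

lemma mfderiv_extChartAt_coordField {p₀ p : M} (hp : p ∈ (extChartAt 𝓘(ℝ, E) p₀).source) (u : E) :
    mfderiv 𝓘(ℝ, E) 𝓘(ℝ, E) (extChartAt 𝓘(ℝ, E) p₀) p (coordField p₀ u p) = u := by
  have : IsManifold 𝓘(ℝ, E) 1 M := IsManifold.of_le (n := ∞) (by simp)
  obtain ⟨e, he⟩ := isInvertible_mfderiv_extChartAt hp
  have h : coordField p₀ u p = e.symm u := by
    change (mfderiv 𝓘(ℝ, E) 𝓘(ℝ, E) (extChartAt 𝓘(ℝ, E) p₀) p).inverse (constField u _) = _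
    rw [← he, ContinuousLinearMap.inverse_equiv]
    rfl
  rw [h, ← he]
  exact e.apply_symm_apply u

lemma exists_coordField_eq {p₀ p : M} (hp : p ∈ (extChartAt 𝓘(ℝ, E) p₀).source)
    (w : TangentSpace 𝓘(ℝ, E) p) : ∃ u : E, coordField p₀ u p = w := by
  have : IsManifold 𝓘(ℝ, E) 1 M := IsManifold.of_le (n := ∞) (by simp)
  obtain ⟨e, he⟩ := isInvertible_mfderiv_extChartAt hp
  refine ⟨e w, ?_⟩
  change (mfderiv 𝓘(ℝ, E) 𝓘(ℝ, E) (extChartAt 𝓘(ℝ, E) p₀) p).inverse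
    (constField (E := E) (e w) (extChartAt 𝓘(ℝ, E) p₀ p)) = w
  rw [← he, ContinuousLinearMap.inverse_equiv]
  exact e.symm_apply_apply w

lemma contMDiff_constField (u : E) :
    ContMDiff 𝓘(ℝ, E) 𝓘(ℝ, E).tangent ∞
      (fun x : E ↦ (⟨x, constField u x⟩ : TangentBundle 𝓘(ℝ, E) E)) := by
  rw [contMDiff_vectorSpace_iff_contDiff]
  exact contDiff_const

lemma contMDiffAt_coordField [CompleteSpace E] {p₀ p : M} (hp : p ∈ (extChartAt 𝓘(ℝ, E) p₀).source)
    (u : E) : ContMDiffAt 𝓘(ℝ, E) 𝓘(ℝ, E).tangent ∞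
      (fun q : M ↦ (⟨q, coordField p₀ u q⟩ : TangentBundle 𝓘(ℝ, E) M)) p := by
  have : IsManifold 𝓘(ℝ, E) 1 M := IsManifold.of_le (n := ∞) (by simp)
  exact ContMDiffAt.mpullback_vectorField_preimage (contMDiff_constField u _)
    (contMDiffAt_extChartAt' (by simpa using hp)) (isInvertible_mfderiv_extChartAt hp)
    (n := ∞) (by simp)

/-- Pullback commutes with brackets, and constant fields commute. This removes the bracket term from
`dΩ` on coordinate fields. -/
lemma mlieBracket_coordField [CompleteSpace E] {p₀ p : M}
    (hp : p ∈ (extChartAt 𝓘(ℝ, E) p₀).source) (u v : E) :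
    VectorField.mlieBracket 𝓘(ℝ, E) (coordField p₀ u) (coordField p₀ v) p = 0 := by
  have : IsManifold 𝓘(ℝ, E) (minSmoothness ℝ 2) M := by
    rw [minSmoothness_of_isRCLikeNormedField]
    exact IsManifold.of_le (n := ∞) (WithTop.coe_le_coe.2 le_top)
  have h := VectorField.mpullback_mlieBracket (n := ∞) (x₀ := p) (I := 𝓘(ℝ, E)) (I' := 𝓘(ℝ, E))
    (f := extChartAt 𝓘(ℝ, E) p₀) (V := constField u) (W := constField v)
    ((contMDiff_constField u _).mdifferentiableAt (by simp))
    ((contMDiff_constField v _).mdifferentiableAt (by simp))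
    (contMDiffAt_extChartAt' (by simpa using hp)) 
    (by rw [minSmoothness_of_isRCLikeNormedField]; exact WithTop.coe_le_coe.2 le_top)
  have h0 : VectorField.mlieBracket 𝓘(ℝ, E) (constField u) (constField v) = 0 := by
    rw [← VectorField.mlieBracketWithin_univ, VectorField.mlieBracketWithin_eq_lieBracketWithin]
    ext x
    change fderivWithin ℝ (fun _ : E ↦ v) Set.univ x u
      - fderivWithin ℝ (fun _ : E ↦ u) Set.univ x v = 0
    simp
  unfold coordField
  rw [← h, h0, VectorField.mpullback_zero]
  rfl

namespace OneForm

/-- A one-form in the preferred chart at `p₀`. -/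
noncomputable def inChart (Ω : OneForm 𝓘(ℝ, E) M V) (p₀ : M) (y : E) : E →L[ℝ] V :=
  (Ω ((extChartAt 𝓘(ℝ, E) p₀).symm y)) ∘L
    (mfderiv 𝓘(ℝ, E) 𝓘(ℝ, E) (extChartAt 𝓘(ℝ, E) p₀) ((extChartAt 𝓘(ℝ, E) p₀).symm y)).inverse

variable (Ω : OneForm 𝓘(ℝ, E) M V) {p₀ p : M}

lemma inChart_apply (hp : p ∈ (extChartAt 𝓘(ℝ, E) p₀).source) (u : E) :
    Ω.inChart p₀ (extChartAt 𝓘(ℝ, E) p₀ p) u = Ω p (coordField p₀ u p) := by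
  change Ω ((extChartAt 𝓘(ℝ, E) p₀).symm (extChartAt 𝓘(ℝ, E) p₀ p))
    (coordField p₀ u ((extChartAt 𝓘(ℝ, E) p₀).symm (extChartAt 𝓘(ℝ, E) p₀ p))) = _
  rw [(extChartAt 𝓘(ℝ, E) p₀).left_inv hp]

lemma contDiffOn_inChart [FiniteDimensional ℝ E] (p₀ : M) :
    ContDiffOn ℝ ∞ (Ω.inChart p₀) (extChartAt 𝓘(ℝ, E) p₀).target := by
  have : CompleteSpace E := FiniteDimensional.complete ℝ E
  rw [contDiffOn_clm_apply]
  intro u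
  rw [← contMDiffOn_iff_contDiffOn]
  intro y hy
  have hp := (extChartAt 𝓘(ℝ, E) p₀).map_target hy
  have h1 : ContMDiffAt 𝓘(ℝ, E) 𝓘(ℝ, V) ∞ (fun q : M ↦ Ω q (coordField p₀ u q))
      ((extChartAt 𝓘(ℝ, E) p₀).symm y) :=
    ContMDiffAt.comp _ (Ω.contMDiff_toFun _) (contMDiffAt_coordField hp u)
  exact h1.comp_contMDiffWithinAt y (contMDiffOn_extChartAt_symm p₀ y hy)

lemma contDiffAt_inChart [FiniteDimensional ℝ E] (hp : p ∈ (extChartAt 𝓘(ℝ, E) p₀).source) :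
    ContDiffAt ℝ ∞ (Ω.inChart p₀) (extChartAt 𝓘(ℝ, E) p₀ p) :=
  (Ω.contDiffOn_inChart p₀).contDiffAt 
    (extChartAt_target_mem_nhds' ((extChartAt 𝓘(ℝ, E) p₀).map_source hp))

/-- The bridge from `D` on `M` to ordinary calculus in `E`. -/
lemma flatDeriv_coordField [FiniteDimensional ℝ E] (hp : p ∈ (extChartAt 𝓘(ℝ, E) p₀).source)
    (u v : E) : Ω.flatDeriv (coordField p₀ u) (coordField p₀ v) p
      = fderiv ℝ (Ω.inChart p₀) (extChartAt 𝓘(ℝ, E) p₀ p) u v := by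
  have : IsManifold 𝓘(ℝ, E) 1 M := IsManifold.of_le (n := ∞) (by simp)
  have heq : (fun q : M ↦ Ω q (coordField p₀ v q)) =ᶠ[𝓝 p]
      (fun y ↦ Ω.inChart p₀ y v) ∘ extChartAt 𝓘(ℝ, E) p₀ := by
    filter_upwards [extChartAt_source_mem_nhds' hp] with q hq
    exact (Ω.inChart_apply hq v).symm
  have hd : HasFDerivAt (fun y ↦ Ω.inChart p₀ y v)
      ((fderiv ℝ (Ω.inChart p₀) (extChartAt 𝓘(ℝ, E) p₀ p)).flip v) (extChartAt 𝓘(ℝ, E) p₀ p) := by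
    have h := ((Ω.contDiffAt_inChart hp).differentiableAt (by simp)).hasFDerivAt.clm_apply
      (hasFDerivAt_const v _)
    convert h using 1
    ext; simp
  have hc := (hd.hasMFDerivAt.comp p
    ((mdifferentiableAt_extChartAt (by simpa using hp)).hasMFDerivAt)).congr_of_eventuallyEq heq
  have h2 := mfderiv_extChartAt_coordField hp u
  change mfderiv 𝓘(ℝ, E) 𝓘(ℝ, V) (fun q : M ↦ Ω q (coordField p₀ v q)) p (coordField p₀ u p) = _
  rw [hc.mfderiv]
  change fderiv ℝ (Ω.inChart p₀) (extChartAt 𝓘(ℝ, E) p₀ p)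
    (mfderiv 𝓘(ℝ, E) 𝓘(ℝ, E) (extChartAt 𝓘(ℝ, E) p₀) p (coordField p₀ u p)) v = _
  rw [h2]

end OneForm

namespace VirtualImmersion

variable [FiniteDimensional ℝ E] [Bundle.RiemannianBundle (fun x : M ↦ TangentSpace 𝓘(ℝ, E) x)]
  {B : PseudoEuclideanForm V} (Ω : VirtualImmersion 𝓘(ℝ, E) M B) {p₀ p : M}

/-- Condition (b) on commuting coordinate fields: the induced connection is torsion-free. -/
lemma form_fderiv_inChart (hp : p ∈ (extChartAt 𝓘(ℝ, E) p₀).source) (u v w : E) :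
    B.form (fderiv ℝ (Ω.inChart p₀) (extChartAt 𝓘(ℝ, E) p₀ p) u v)
        (Ω.inChart p₀ (extChartAt 𝓘(ℝ, E) p₀ p) w)
      = B.form (fderiv ℝ (Ω.inChart p₀) (extChartAt 𝓘(ℝ, E) p₀ p) v u)
        (Ω.inChart p₀ (extChartAt 𝓘(ℝ, E) p₀ p) w) := by
  have : CompleteSpace E := FiniteDimensional.complete ℝ E
  have h := Ω.extDeriv_normal p (coordField p₀ u p) (coordField p₀ v p) (coordField p₀ w p)
  rw [Ω.extDeriv_apply ((contMDiffAt_coordField hp u).mdifferentiableAt (by simp))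
    ((contMDiffAt_coordField hp v).mdifferentiableAt (by simp)), mlieBracket_coordField hp,
    Ω.flatDeriv_coordField hp, Ω.flatDeriv_coordField hp, ← Ω.inChart_apply hp w] at h
  simpa [sub_eq_zero] using h

/-- Skew-symmetry kills the normal part of the symmetrized derivative, and the kernel of the normal
projection is the tangent image. -/
lemma sym_fderiv_inChart_mem_range [FiniteDimensional ℝ V] (hskew : Ω.IsSkew)
    (hp : p ∈ (extChartAt 𝓘(ℝ, E) p₀).source) (u v : E) :
    fderiv ℝ (Ω.inChart p₀) (extChartAt 𝓘(ℝ, E) p₀ p) u v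
      + fderiv ℝ (Ω.inChart p₀) (extChartAt 𝓘(ℝ, E) p₀ p) v u
      ∈ Set.range (Ω.inChart p₀ (extChartAt 𝓘(ℝ, E) p₀ p)) := by
  have : CompleteSpace E := FiniteDimensional.complete ℝ E
  have hd (u : E) := (contMDiffAt_coordField hp u).mdifferentiableAt (n := ∞) (by simp)
  have h := hskew p (coordField p₀ u p) (coordField p₀ v p)
  rw [Ω.secondFundamentalForm_apply (hd u) (hd v), Ω.secondFundamentalForm_apply (hd v) (hd u),
    Ω.flatDeriv_coordField hp, Ω.flatDeriv_coordField hp, eq_neg_iff_add_eq_zero, ← map_add] at h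
  obtain ⟨w, hw⟩ := (Submodule.projection_apply_eq_zero_iff (Ω.isCompl_normal_tangent p)).1 h
  obtain ⟨z, rfl⟩ := exists_coordField_eq hp w
  exact ⟨z, (Ω.inChart_apply hp z).trans hw⟩

end VirtualImmersion

end Chart

end VirtualImm

/-! ### Linear algebra: equal Gram matrices -/

/-- Two families of vectors that span nondegenerate spaces and have the same Gram matrix are related
by a linear isometry. -/
lemma exists_linearEquiv_of_form_eq {ι V₁ V₂ : Type*}
    [AddCommGroup V₁] [Module ℝ V₁] [AddCommGroup V₂] [Module ℝ V₂]
    {B₁ : LinearMap.BilinForm ℝ V₁} {B₂ : LinearMap.BilinForm ℝ V₂}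
    (h₁ : B₁.Nondegenerate) (h₂ : B₂.Nondegenerate) {f₁ : ι → V₁} {f₂ : ι → V₂}
    (hs₁ : Submodule.span ℝ (Set.range f₁) = ⊤) (hs₂ : Submodule.span ℝ (Set.range f₂) = ⊤)
    (h : ∀ i j, B₁ (f₁ i) (f₁ j) = B₂ (f₂ i) (f₂ j)) :
    ∃ L : V₁ ≃ₗ[ℝ] V₂, (∀ v w, B₂ (L v) (L w) = B₁ v w) ∧ ∀ i, L (f₁ i) = f₂ i := by
  let T₁ := Finsupp.linearCombination ℝ f₁
  let T₂ := Finsupp.linearCombination ℝ f₂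
  have hT₁ : Function.Surjective T₁ := by
    rw [← LinearMap.range_eq_top, Finsupp.range_linearCombination, hs₁]
  have hT₂ : Function.Surjective T₂ := by
    rw [← LinearMap.range_eq_top, Finsupp.range_linearCombination, hs₂]
  have hT (a b : ι →₀ ℝ) : B₁ (T₁ a) (T₁ b) = B₂ (T₂ a) (T₂ b) := by
    have : B₁.compl₁₂ T₁ T₁ = B₂.compl₁₂ T₂ T₂ := by
      ext i j
      simp [T₁, T₂, h]
    exact congr($this a b)
  -- By nondegeneracy and spanning, a combination vanishes iff it pairs to zero with all
  -- combinations, a condition on the common Gram matrix alone.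
  have hker : LinearMap.ker T₁ = LinearMap.ker T₂ := by
    ext a
    rw [LinearMap.mem_ker, LinearMap.mem_ker]
    constructor
    · intro ha
      refine h₂.1 _ fun y ↦ ?_
      obtain ⟨b, rfl⟩ := hT₂ y
      rw [← hT, ha, map_zero, LinearMap.zero_apply]
    · intro ha
      refine h₁.1 _ fun y ↦ ?_
      obtain ⟨b, rfl⟩ := hT₁ y
      rw [hT, ha, map_zero, LinearMap.zero_apply]
  let L : V₁ ≃ₗ[ℝ] V₂ := (T₁.quotKerEquivOfSurjective hT₁).symm ≪≫ₗ
    Submodule.quotEquivOfEq _ _ hker ≪≫ₗ T₂.quotKerEquivOfSurjective hT₂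
  have hL (a : ι →₀ ℝ) : L (T₁ a) = T₂ a := by
    have : (T₁.quotKerEquivOfSurjective hT₁).symm (T₁ a) = Submodule.Quotient.mk a := by
      rw [LinearEquiv.symm_apply_eq]; rfl
    simp only [L, LinearEquiv.trans_apply, this]
    rfl
  refine ⟨L, fun v w ↦ ?_, fun i ↦ ?_⟩
  · obtain ⟨a, rfl⟩ := hT₁ v
    obtain ⟨b, rfl⟩ := hT₁ w
    rw [hL, hL, hT]
  · simpa [T₁, T₂] using hL (Finsupp.single i 1)

namespace VirtualImm

/-! ### Comparison of two virtual immersions -/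

section Pair

set_option maxSynthPendingDepth 3

variable {E : Type*} [NormedAddCommGroup E] [NormedSpace ℝ E] [FiniteDimensional ℝ E]
  {M : Type*} [TopologicalSpace M] [ChartedSpace E M] [IsManifold 𝓘(ℝ, E) ∞ M]
  [Bundle.RiemannianBundle (fun x : M ↦ TangentSpace 𝓘(ℝ, E) x)]
  {V₁ : Type*} [NormedAddCommGroup V₁] [NormedSpace ℝ V₁]
  {V₂ : Type*} [NormedAddCommGroup V₂] [NormedSpace ℝ V₂]
  {B₁ : PseudoEuclideanForm V₁} {B₂ : PseudoEuclideanForm V₂}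

namespace VirtualImmersion

/-- The derivative of a bilinear form along two smooth one-forms in a chart. -/
lemma hasFDerivAt_form_inChart [FiniteDimensional ℝ V₁]
    (Ω : VirtualImmersion 𝓘(ℝ, E) M B₁) {p₀ p : M}
    (hp : p ∈ (extChartAt 𝓘(ℝ, E) p₀).source) (u v : E) :
    ∃ D : E →L[ℝ] ℝ, HasFDerivAt
      (fun y ↦ B₁.form (Ω.inChart p₀ y u) (Ω.inChart p₀ y v)) D (extChartAt 𝓘(ℝ, E) p₀ p) ∧
      ∀ a, D a = B₁.form (fderiv ℝ (Ω.inChart p₀) (extChartAt 𝓘(ℝ, E) p₀ p) a u)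
          (Ω.inChart p₀ (extChartAt 𝓘(ℝ, E) p₀ p) v)
        + B₁.form (fderiv ℝ (Ω.inChart p₀) (extChartAt 𝓘(ℝ, E) p₀ p) a v)
          (Ω.inChart p₀ (extChartAt 𝓘(ℝ, E) p₀ p) u) := by
  have hd := ((Ω.contDiffAt_inChart hp).differentiableAt (by simp)).hasFDerivAt
  have h (w : E) := hd.clm_apply (hasFDerivAt_const w _)
  have hB : ∃ b : V₁ →L[ℝ] V₁ →L[ℝ] ℝ, ∀ x y, b x y = B₁.form x y :=
    ⟨LinearMap.toContinuousLinearMap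
      ((LinearMap.toContinuousLinearMap (𝕜 := ℝ) (E := V₁) (F' := ℝ)).toLinearMap ∘ₗ B₁.form),
      fun _ _ ↦ rfl⟩
  obtain ⟨b, hb⟩ := hB
  have h2 := ((b.hasFDerivAt.comp _ (h u)).clm_apply (h v))
  refine ⟨_, h2.congr_of_eventuallyEq (Eventually.of_forall fun y ↦ (hb _ _).symm), fun a ↦ ?_⟩
  have hs := B₁.symm.eq (fderiv ℝ (Ω.inChart p₀) (extChartAt 𝓘(ℝ, E) p₀ p) a v)
    (Ω.inChart p₀ (extChartAt 𝓘(ℝ, E) p₀ p) u)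
  rw [hs]
  simp [hb, add_comm]

variable (Ω₁ : VirtualImmersion 𝓘(ℝ, E) M B₁) (Ω₂ : VirtualImmersion 𝓘(ℝ, E) M B₂)

lemma form_inChart_eq {p₀ p : M} (hp : p ∈ (extChartAt 𝓘(ℝ, E) p₀).source) (u v : E) :
    B₁.form (Ω₁.inChart p₀ (extChartAt 𝓘(ℝ, E) p₀ p) u)
        (Ω₁.inChart p₀ (extChartAt 𝓘(ℝ, E) p₀ p) v)
      = B₂.form (Ω₂.inChart p₀ (extChartAt 𝓘(ℝ, E) p₀ p) u)
        (Ω₂.inChart p₀ (extChartAt 𝓘(ℝ, E) p₀ p) v) := by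
  simp only [OneForm.inChart_apply _ hp]
  rw [Ω₁.isometric, Ω₂.isometric]

/-- The tangential part of the derivative of a virtual immersion in a chart (its Christoffel
symbols of the first kind) is determined by the metric. -/
lemma form_fderiv_inChart_eq [FiniteDimensional ℝ V₁] [FiniteDimensional ℝ V₂]
    {p₀ p : M} (hp : p ∈ (extChartAt 𝓘(ℝ, E) p₀).source) (u v w : E) :
    B₁.form (fderiv ℝ (Ω₁.inChart p₀) (extChartAt 𝓘(ℝ, E) p₀ p) u v)
        (Ω₁.inChart p₀ (extChartAt 𝓘(ℝ, E) p₀ p) w)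
      = B₂.form (fderiv ℝ (Ω₂.inChart p₀) (extChartAt 𝓘(ℝ, E) p₀ p) u v)
        (Ω₂.inChart p₀ (extChartAt 𝓘(ℝ, E) p₀ p) w) := by
  have key (v w : E) : (fun y ↦ B₁.form (Ω₁.inChart p₀ y v) (Ω₁.inChart p₀ y w))
      =ᶠ[𝓝 (extChartAt 𝓘(ℝ, E) p₀ p)]
      fun y ↦ B₂.form (Ω₂.inChart p₀ y v) (Ω₂.inChart p₀ y w) := by
    filter_upwards [extChartAt_target_mem_nhds' ((extChartAt 𝓘(ℝ, E) p₀).map_source hp)] with y hy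
    have := form_inChart_eq Ω₁ Ω₂ ((extChartAt 𝓘(ℝ, E) p₀).map_target hy) v w
    rwa [(extChartAt 𝓘(ℝ, E) p₀).right_inv hy] at this
  have hder (a v w : E) :
      B₁.form (fderiv ℝ (Ω₁.inChart p₀) (extChartAt 𝓘(ℝ, E) p₀ p) a v)
          (Ω₁.inChart p₀ (extChartAt 𝓘(ℝ, E) p₀ p) w)
        + B₁.form (fderiv ℝ (Ω₁.inChart p₀) (extChartAt 𝓘(ℝ, E) p₀ p) a w)
          (Ω₁.inChart p₀ (extChartAt 𝓘(ℝ, E) p₀ p) v)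
      = B₂.form (fderiv ℝ (Ω₂.inChart p₀) (extChartAt 𝓘(ℝ, E) p₀ p) a v)
          (Ω₂.inChart p₀ (extChartAt 𝓘(ℝ, E) p₀ p) w)
        + B₂.form (fderiv ℝ (Ω₂.inChart p₀) (extChartAt 𝓘(ℝ, E) p₀ p) a w)
          (Ω₂.inChart p₀ (extChartAt 𝓘(ℝ, E) p₀ p) v) := by
    obtain ⟨D₁, h₁, h₁'⟩ := Ω₁.hasFDerivAt_form_inChart hp v w
    obtain ⟨D₂, h₂, h₂'⟩ := Ω₂.hasFDerivAt_form_inChart hp v w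
    have h := congr($(h₁.unique (h₂.congr_of_eventuallyEq (key v w))) a)
    rw [h₁', h₂'] at h
    exact h
  have e₁ := Ω₁.form_fderiv_inChart hp
  have e₂ := Ω₂.form_fderiv_inChart hp
  -- Koszul's formula: the cyclic metric derivatives `hder` agree for both immersions, and
  -- torsion-freeness solves for the single term.
  linarith [hder u v w, hder v w u, hder w u v, e₁ u v w, e₂ u v w, e₁ u w v, e₂ u w v,
    e₁ v w u, e₂ v w u]

/-- Two virtual immersions in the preferred chart at `p₀`, as a one-form with values in the sum of
the target spaces. -/
noncomputable def pairInChart (p₀ : M) (y : E) : E →L[ℝ] V₁ × V₂ :=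
  (Ω₁.inChart p₀ y).prod (Ω₂.inChart p₀ y)

variable {p₀ p : M}

lemma contDiffAt_pairInChart (hp : p ∈ (extChartAt 𝓘(ℝ, E) p₀).source) :
    ContDiffAt ℝ ∞ (pairInChart Ω₁ Ω₂ p₀) (extChartAt 𝓘(ℝ, E) p₀ p) := by
  have h : pairInChart Ω₁ Ω₂ p₀ = fun y ↦ ContinuousLinearMap.inl ℝ V₁ V₂ ∘L Ω₁.inChart p₀ y
      + ContinuousLinearMap.inr ℝ V₁ V₂ ∘L Ω₂.inChart p₀ y := by
    ext y u <;> simp [pairInChart]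
  rw [h]
  exact (contDiffAt_const.clm_comp (Ω₁.contDiffAt_inChart hp)).add
    (contDiffAt_const.clm_comp (Ω₂.contDiffAt_inChart hp))

lemma fderiv_pairInChart (hp : p ∈ (extChartAt 𝓘(ℝ, E) p₀).source) (u v : E) :
    fderiv ℝ (pairInChart Ω₁ Ω₂ p₀) (extChartAt 𝓘(ℝ, E) p₀ p) u v
      = (fderiv ℝ (Ω₁.inChart p₀) (extChartAt 𝓘(ℝ, E) p₀ p) u v,
        fderiv ℝ (Ω₂.inChart p₀) (extChartAt 𝓘(ℝ, E) p₀ p) u v) := by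
  have h₁ := ((Ω₁.contDiffAt_inChart hp).differentiableAt (by simp)).hasFDerivAt
  have h₂ := ((Ω₂.contDiffAt_inChart hp).differentiableAt (by simp)).hasFDerivAt
  have h := ((contDiffAt_pairInChart Ω₁ Ω₂ hp).differentiableAt (by simp)).hasFDerivAt
  refine Prod.ext ?_ ?_
  · have h' := ((hasFDerivAt_const (ContinuousLinearMap.fst ℝ V₁ V₂) _).clm_comp h)
    have := congr($(h'.unique h₁) u v)
    simpa using this
  · have h' := ((hasFDerivAt_const (ContinuousLinearMap.snd ℝ V₁ V₂) _).clm_comp h)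
    have := congr($(h'.unique h₂) u v)
    simpa using this

/-- By (a), a vector in the kernel has zero length for the positive definite `g`. -/
lemma injective_inChart (hp : p ∈ (extChartAt 𝓘(ℝ, E) p₀).source) :
    Function.Injective (Ω₁.inChart p₀ (extChartAt 𝓘(ℝ, E) p₀ p)) := by
  rw [injective_iff_map_eq_zero]
  intro u hu
  rw [Ω₁.inChart_apply hp] at hu
  have h := Ω₁.isometric p (coordField p₀ u p) (coordField p₀ u p)
  rw [hu, map_zero, eq_comm, inner_self_eq_zero] at h
  rw [← mfderiv_extChartAt_coordField hp u, h, map_zero]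
  rfl

/-- For skew-symmetric second fundamental forms, the symmetric part of the derivative of the pair
takes values in the image of the pair. -/
lemma sym_fderiv_pairInChart_mem_range [FiniteDimensional ℝ V₁] [FiniteDimensional ℝ V₂]
    (hskew₁ : Ω₁.IsSkew) (hskew₂ : Ω₂.IsSkew)
    (hp : p ∈ (extChartAt 𝓘(ℝ, E) p₀).source) (u v : E) :
    fderiv ℝ (pairInChart Ω₁ Ω₂ p₀) (extChartAt 𝓘(ℝ, E) p₀ p) u v
      + fderiv ℝ (pairInChart Ω₁ Ω₂ p₀) (extChartAt 𝓘(ℝ, E) p₀ p) v u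
      ∈ Set.range (pairInChart Ω₁ Ω₂ p₀ (extChartAt 𝓘(ℝ, E) p₀ p)) := by
  obtain ⟨z₁, hz₁⟩ := Ω₁.sym_fderiv_inChart_mem_range hskew₁ hp u v
  obtain ⟨z₂, hz₂⟩ := Ω₂.sym_fderiv_inChart_mem_range hskew₂ hp u v
  -- Both are the same Christoffel term: their pairings with tangent vectors are determined by the
  -- metric, which is definite on the tangent image even if `B₁.form` is not.
  have hz : z₁ = z₂ := by
    refine injective_inChart Ω₁ hp (sub_eq_zero.1 ?_)
    rw [← map_sub]
    have h (w : E) : B₁.form (Ω₁.inChart p₀ (extChartAt 𝓘(ℝ, E) p₀ p) (z₁ - z₂))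
        (Ω₁.inChart p₀ (extChartAt 𝓘(ℝ, E) p₀ p) w) = 0 := by
      rw [map_sub, map_sub, LinearMap.sub_apply, form_inChart_eq Ω₁ Ω₂ hp z₂, hz₁, hz₂, map_add,
        map_add, LinearMap.add_apply, LinearMap.add_apply, form_fderiv_inChart_eq Ω₁ Ω₂ hp u v,
        form_fderiv_inChart_eq Ω₁ Ω₂ hp v u, sub_self]
    have h' := h (z₁ - z₂)
    rw [Ω₁.inChart_apply hp] at h' ⊢
    rw [Ω₁.isometric, inner_self_eq_zero] at h'
    rw [h', map_zero]
  subst hz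
  refine ⟨z₁, ?_⟩
  rw [fderiv_pairInChart Ω₁ Ω₂ hp, fderiv_pairInChart Ω₁ Ω₂ hp, Prod.mk_add_mk, ← hz₁, ← hz₂]
  rfl

lemma pairInChart_apply (hp : p ∈ (extChartAt 𝓘(ℝ, E) p₀).source) (u : E) :
    pairInChart Ω₁ Ω₂ p₀ (extChartAt 𝓘(ℝ, E) p₀ p) u
      = (Ω₁ p (coordField p₀ u p), Ω₂ p (coordField p₀ u p)) := by
  rw [← Ω₁.inChart_apply hp, ← Ω₂.inChart_apply hp]
  rfl

/-- Near any point, a functional that annihilates a pair of virtual immersions with skew-symmetric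
second fundamental forms to first order at one point annihilates the pair. -/
lemma exists_nhds_forall_annihilate [FiniteDimensional ℝ V₁] [FiniteDimensional ℝ V₂]
    (hskew₁ : Ω₁.IsSkew) (hskew₂ : Ω₂.IsSkew) (p₀ : M) :
    ∃ U ∈ 𝓝 p₀, U ⊆ (extChartAt 𝓘(ℝ, E) p₀).source ∧ ∀ p ∈ U, ∀ φ : V₁ × V₂ →L[ℝ] ℝ,
      (∀ u, φ (pairInChart Ω₁ Ω₂ p₀ (extChartAt 𝓘(ℝ, E) p₀ p) u) = 0) →
      (∀ u v, φ (fderiv ℝ (pairInChart Ω₁ Ω₂ p₀) (extChartAt 𝓘(ℝ, E) p₀ p) u v) = 0) →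
      ∀ q ∈ U, ∀ w, φ (Ω₁ q w, Ω₂ q w) = 0 := by
  have hp₀ := mem_extChartAt_source (I := 𝓘(ℝ, E)) p₀
  obtain ⟨r, hr, h⟩ := exists_ball_forall_annihilate (contDiffAt_pairInChart Ω₁ Ω₂ hp₀)
    (fun u v huv ↦ injective_inChart Ω₁ hp₀ (congrArg Prod.fst huv)) (by
      filter_upwards [extChartAt_target_mem_nhds (I := 𝓘(ℝ, E)) p₀] with y hy
      have := sym_fderiv_pairInChart_mem_range Ω₁ Ω₂ hskew₁ hskew₂
        ((extChartAt 𝓘(ℝ, E) p₀).map_target hy)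
      rwa [(extChartAt 𝓘(ℝ, E) p₀).right_inv hy] at this)
  refine ⟨(extChartAt 𝓘(ℝ, E) p₀).source ∩ extChartAt 𝓘(ℝ, E) p₀ ⁻¹'
    Metric.ball (extChartAt 𝓘(ℝ, E) p₀ p₀) r, inter_mem (extChartAt_source_mem_nhds p₀)
      ((continuousAt_extChartAt p₀).preimage_mem_nhds (Metric.ball_mem_nhds _ hr)),
    Set.inter_subset_left, fun p hp φ h0 h1 q hq w ↦ ?_⟩
  obtain ⟨u, rfl⟩ := exists_coordField_eq hq.1 w
  rw [← pairInChart_apply Ω₁ Ω₂ hq.1]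
  exact h _ hp.2 φ h0 h1 _ hq.2 u

/-- If a functional annihilates a pair of virtual immersions near some point of a connected
manifold, then it annihilates the pair everywhere. -/
lemma annihilate_of_eventually [FiniteDimensional ℝ V₁] [FiniteDimensional ℝ V₂]
    [ConnectedSpace M] (hskew₁ : Ω₁.IsSkew) (hskew₂ : Ω₂.IsSkew)
    {φ : V₁ × V₂ →L[ℝ] ℝ} (h : ∀ᶠ q in 𝓝 p, ∀ w, φ (Ω₁ q w, Ω₂ q w) = 0) (q : M)
    (w : TangentSpace 𝓘(ℝ, E) q) : φ (Ω₁ q w, Ω₂ q w) = 0 := by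
  let S : Set M := {p | ∀ᶠ q in 𝓝 p, ∀ w, φ (Ω₁ q w, Ω₂ q w) = 0}
  have hopen : IsOpen S := isOpen_setOfPred_eventually_nhds
  have hclosed : IsClosed S := by
    -- A limit point `p₀` has a neighbourhood `U` in which any point may serve as the starting
    -- point; one in `U ∩ S` forces annihilation on all of `U`.
    refine isClosed_of_closure_subset fun p₀ hp₀ ↦ ?_
    obtain ⟨U, hU, hUs, h⟩ := exists_nhds_forall_annihilate Ω₁ Ω₂ hskew₁ hskew₂ p₀
    obtain ⟨y, hyU, hyS⟩ := mem_closure_iff_nhds.1 hp₀ U hU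
    have hy := hUs hyU
    have hz : ∀ᶠ z in 𝓝 (extChartAt 𝓘(ℝ, E) p₀ y), ∀ u, φ (pairInChart Ω₁ Ω₂ p₀ z u) = 0 := by
      have hc := (continuousAt_extChartAt_symm'' ((extChartAt 𝓘(ℝ, E) p₀).map_source hy)).eventually
        (p := fun q ↦ ∀ w, φ (Ω₁ q w, Ω₂ q w) = 0)
        (by rw [(extChartAt 𝓘(ℝ, E) p₀).left_inv hy]; exact hyS)
      filter_upwards [hc, extChartAt_target_mem_nhds' ((extChartAt 𝓘(ℝ, E) p₀).map_source hy)]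
        with z hz hzt u
      have := pairInChart_apply Ω₁ Ω₂ ((extChartAt 𝓘(ℝ, E) p₀).map_target hzt) u
      rw [(extChartAt 𝓘(ℝ, E) p₀).right_inv hzt] at this
      rw [this]
      exact hz _
    -- The composite of `φ` with the pair vanishes near `y`, so its derivative there vanishes too.
    refine mem_of_superset hU fun q hq ↦ h y hyU φ hz.self_of_nhds (fun u v ↦ ?_) q hq
    have hd := ((contDiffAt_pairInChart Ω₁ Ω₂ hy).differentiableAt (by simp)).hasFDerivAt
    have h1 := φ.hasFDerivAt.comp _ (hd.clm_apply (hasFDerivAt_const v _))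
    have h2 := h1.unique ((hasFDerivAt_const (0 : ℝ) _).congr_of_eventuallyEq
      (hz.mono fun z hz ↦ hz v))
    simpa using congr($h2 u)
  have huniv : S = Set.univ := IsClopen.eq_univ ⟨hclosed, hopen⟩ ⟨p, h⟩
  have hq : q ∈ S := huniv ▸ Set.mem_univ q
  exact Eventually.self_of_nhds hq w

/-- The scalar products between the values of a virtual immersion with skew-symmetric second
fundamental form, at arbitrary points, do not depend on the virtual immersion. -/
lemma form_apply_eq [FiniteDimensional ℝ V₁] [FiniteDimensional ℝ V₂]
    [ConnectedSpace M] (hskew₁ : Ω₁.IsSkew) (hskew₂ : Ω₂.IsSkew) (p q : M)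
    (u : TangentSpace 𝓘(ℝ, E) p) (w : TangentSpace 𝓘(ℝ, E) q) :
    B₁.form (Ω₁ p u) (Ω₁ q w) = B₂.form (Ω₂ p u) (Ω₂ q w) := by
  let φ : V₁ × V₂ →L[ℝ] ℝ := LinearMap.toContinuousLinearMap
    (B₁.form (Ω₁ p u) ∘ₗ LinearMap.fst ℝ V₁ V₂ - B₂.form (Ω₂ p u) ∘ₗ LinearMap.snd ℝ V₁ V₂)
  have hφ (x : V₁) (y : V₂) : φ (x, y) = B₁.form (Ω₁ p u) x - B₂.form (Ω₂ p u) y := rfl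
  have hp := mem_extChartAt_source (I := 𝓘(ℝ, E)) p
  obtain ⟨a, rfl⟩ := exists_coordField_eq hp u
  obtain ⟨U, hU, -, h⟩ := exists_nhds_forall_annihilate Ω₁ Ω₂ hskew₁ hskew₂ p
  have h' := annihilate_of_eventually Ω₁ Ω₂ hskew₁ hskew₂ (φ := φ) (p := p)
    (mem_of_superset hU (h p (mem_of_mem_nhds hU) φ (fun b ↦ ?_) fun b c ↦ ?_)) q w
  · rw [hφ] at h'
    exact sub_eq_zero.1 h'
  · rw [pairInChart_apply Ω₁ Ω₂ hp, hφ, Ω₁.isometric, Ω₂.isometric, sub_self]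
  -- First order: with the arguments swapped by symmetry of the forms, both terms are Christoffel
  -- symbols of the first kind.
  · rw [fderiv_pairInChart Ω₁ Ω₂ hp, hφ, ← Ω₁.inChart_apply hp, ← Ω₂.inChart_apply hp,
      B₁.symm.eq (Ω₁.inChart p _ a), B₂.symm.eq (Ω₂.inChart p _ a), form_fderiv_inChart_eq Ω₁ Ω₂ hp, sub_self]

end VirtualImmersion

end Pair

end VirtualImm

theorem propositionP
    {E : Type*} [NormedAddCommGroup E] [NormedSpace ℝ E] [FiniteDimensional ℝ E]
    {M : Type*} [TopologicalSpace M] [T2Space M] [SecondCountableTopology M]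
    [ChartedSpace E M] [IsManifold 𝓘(ℝ, E) ∞ M]
    [Bundle.RiemannianBundle (fun x : M ↦ TangentSpace 𝓘(ℝ, E) x)]
    [IsContMDiffRiemannianBundle 𝓘(ℝ, E) ∞ E (fun x : M ↦ TangentSpace 𝓘(ℝ, E) x)]
    (hM : VirtualImm.IsSymmetricSpace 𝓘(ℝ, E) M)
    {V₁ : Type*} [NormedAddCommGroup V₁] [NormedSpace ℝ V₁] [FiniteDimensional ℝ V₁]
    {V₂ : Type*} [NormedAddCommGroup V₂] [NormedSpace ℝ V₂] [FiniteDimensional ℝ V₂]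
    (B₁ : VirtualImm.PseudoEuclideanForm V₁) (B₂ : VirtualImm.PseudoEuclideanForm V₂)
    (Ω₁ : VirtualImm.VirtualImmersion 𝓘(ℝ, E) M B₁)
    (Ω₂ : VirtualImm.VirtualImmersion 𝓘(ℝ, E) M B₂)
    (hskew₁ : Ω₁.IsSkew) (hskew₂ : Ω₂.IsSkew)
    (hfull₁ : Ω₁.IsFull) (hfull₂ : Ω₂.IsFull) :
    Ω₁.Equivalent Ω₂ := by
  have := hM.connected
  -- The families are indexed by all tangent vectors of `M`, so fullness is exactly the spanning
  -- condition.
  obtain ⟨L, hL, hL'⟩ := exists_linearEquiv_of_form_eq B₁.nondegenerate B₂.nondegenerate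
    (f₁ := fun i : (x : M) × TangentSpace 𝓘(ℝ, E) x ↦ Ω₁.toFun i.1 i.2)
    (f₂ := fun i : (x : M) × TangentSpace 𝓘(ℝ, E) x ↦ Ω₂.toFun i.1 i.2)
    (by
      refine Eq.trans (congrArg _ ?_) hfull₁
      ext w
      simp)
    (by
      refine Eq.trans (congrArg _ ?_) hfull₂
      ext w
      simp)
    fun i j ↦ VirtualImm.VirtualImmersion.form_apply_eq Ω₁ Ω₂ hskew₁ hskew₂ i.1 j.1 i.2 j.2
  exact ⟨L, hL, fun x u ↦ hL' ⟨x, u⟩⟩
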